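/- Let $A\in\mathbb C^{n\times n}$, $B\in\mathbb C^{n\times m}$, $C\in\mathbb C^{m\times n}$, $D\in\mathbb C^{m\times m}$ with $n,m\ge 1$, and suppose that $\mathcal M=\{A,B,C,D\}$ is minimal, i.e. $\operatorname{rank}[\,sI-A\mid B\,]=n$ and $\operatorname{rank}[\,sI-A^{\mathsf H}\mid C^{\mathsf H}\,]=n$ for all $s\in\mathbb C$. For $\xi\in\mathbb R$ let $$\mathcal M_\xi=\{A+\tfrac{\xi}{2}I_n,\,B,\,C,\,D-\tfrac{\xi}{2}I_m\},\qquad \mathcal T_\xi(s)=C\big(sI_n-A-\tfrac{\xi}{2}I_n\big)^{-1}B+D-\tfrac{\xi}{2}I_m,$$ $$\Phi_\xi(s)=\mathcal T_\xi(-\bar s)^{\mathsf H}+\mathcal T_\xi(s),\qquad \Phi_\xi(\infty)=D^{\mathsf H}+D-\xi I_m,$$ and $\gamma(\xi,\omega)=\lambda_{\min}\Phi_\xi(\imath\omega)$ for $\omega\in\mathbb R$, $\gamma(\xi,\infty)=\lambda_{\min}\Phi_\xi(\infty)$. For real $\omega$, $\gamma(\xi,\omega)$ is defined when $\imath\omega$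 is not an eigenvalue of $A+\frac{\xi}{2}I_n$. The system $\mathcal M_\xi$ is called strictly passive if all eigenvalues of $A+\frac{\xi}{2}I_n$ lie in the open left half plane and $\Phi_\xi(\imath\omega)>0$ for all $\omega\in\mathbb R\cup\{\infty\}$. Put $$\Xi=\sup\{\xi\in\mathbb R:\ \mathcal M_\xi\text{ is strictly passive}\},\qquad \Xi_{up}=\min\Big[\,2\min_j(-\Re\lambda_j(A)),\ \min_i\lambda_i(D^{\mathsf H}+D)\Big].$$ Then the set in the definition of $\Xi$ is non-empty and bounded above, so $\Xi$ is a finite supremum, and: 1. $\gamma$ is continuous in $(\xi,\omega)$ on the set of all $(\xi,\omega)\in\mathbb R^2$ at which it is defined. 2. For every $\xi\in[0,\Xi)$, $\gamma(\xi,\omega)$ is defined for all $\omega\in\mathbb R$, and $\gamma(\xi,\omega)>0$ for all $\omega\in\mathbb R\cup\{\infty\}$. 3. If $\gamma(\Xi,\omega)$ is defined for all $\omega\in\mathbb R$ (that is, $A+\frac{\Xi}{2}I_n$ has no purely imaginary eigenvalue), then $\gamma(\Xi,\omega)=0$ for at least one $\omega\in\mathbb R\cup\{\infty\}$. 4. For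 every $\xi\in(\Xi,\Xi_{up}]$ such that $\gamma(\xi,\omega)$ is defined for all $\omega\in\mathbb R$ (which is automatic if $\xi<2\min_j(-\Re\lambda_j(A))$), there is a non-empty open interval of real $\omega$ on which $\gamma(\xi,\omega)<0$. -/

import Mathlib

open scoped Matrix ComplexOrder

/-- A linear time-invariant system `x' = A x + B u`, `y = C x + D u` with `n` states and `m` inputs
and outputs, over `ℂ`. -/
structure LTISystem (n m : ℕ) where
  A : Matrix (Fin n) (Fin n) ℂ
  B : Matrix (Fin n) (Fin m) ℂ
  C : Matrix (Fin m) (Fin n) ℂ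
  D : Matrix (Fin m) (Fin m) ℂ

/-- Smallest eigenvalue of a Hermitian matrix. (The real spectrum of a Hermitian matrix is the
finite set of its eigenvalues.) -/
noncomputable def lambdaMin {m : ℕ} (H : Matrix (Fin m) (Fin m) ℂ) : ℝ :=
  sInf (spectrum ℝ H)

/-- `(A, B)` is controllable: `[s I - A | B]` has full row rank for every `s ∈ ℂ`. -/
def Controllable {n m : ℕ} (A : Matrix (Fin n) (Fin n) ℂ) (B : Matrix (Fin n) (Fin m) ℂ) : Prop :=
  ∀ s : ℂ, (Matrix.fromCols (s • (1 : Matrix (Fin n) (Fin n) ℂ) - A) B).rank = n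

namespace LTISystem

/-- Controllable and observable. -/
def IsMinimal {n m : ℕ} (M : LTISystem n m) : Prop :=
  Controllable M.A M.B ∧ Controllable M.Aᴴ M.Cᴴ

/-- The transfer function `T(s) = C (s I - A)⁻¹ B + D`. -/
noncomputable def transfer {n m : ℕ} (M : LTISystem n m) (s : ℂ) : Matrix (Fin m) (Fin m) ℂ :=
  M.C * (s • (1 : Matrix (Fin n) (Fin n) ℂ) - M.A)⁻¹ * M.B + M.D

/-- `Φ(s) = Tᴴ(-s) + T(s)`. Here `Tᴴ` is the function obtained from `T` by replacing the coefficient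
matrices by their conjugate transposes, so that `Tᴴ(-s) = Bᴴ (-s I - Aᴴ)⁻¹ Cᴴ + Dᴴ` is the
conjugate transpose of `T` at `-conj s`. -/
noncomputable def Phi {n m : ℕ} (M : LTISystem n m) (s : ℂ) : Matrix (Fin m) (Fin m) ℂ :=
  (M.transfer (-(starRingEnd ℂ s)))ᴴ + M.transfer s

/-- `Φ(∞) = Dᴴ + D`. -/
def PhiInf {n m : ℕ} (M : LTISystem n m) : Matrix (Fin m) (Fin m) ℂ :=
  M.Dᴴ + M.D

/-- All eigenvalues of `A` lie in the open left half plane. -/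
def IsStable {n m : ℕ} (M : LTISystem n m) : Prop :=
  ∀ z ∈ spectrum ℂ M.A, z.re < 0

/-- Strict passivity: asymptotic stability, and `Φ` positive definite on the imaginary axis
with the point `ω = ∞` included. -/
def IsStrictlyPassive {n m : ℕ} (M : LTISystem n m) : Prop :=
  M.IsStable ∧ (∀ ω : ℝ, (M.Phi (Complex.I * (ω : ℂ))).PosDef) ∧ M.PhiInf.PosDef

/-- The shifted system `M_ξ = {A + (ξ/2) I, B, C, D - (ξ/2) I}`. -/
noncomputable def shift {n m : ℕ} (M : LTISystem n m) (ξ : ℝ) : LTISystem n m where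
  A := M.A + ((ξ : ℂ) / 2) • (1 : Matrix (Fin n) (Fin n) ℂ)
  B := M.B
  C := M.C
  D := M.D - ((ξ : ℂ) / 2) • (1 : Matrix (Fin m) (Fin m) ℂ)

/-- The set of `ξ` for which the shifted system is strictly passive. -/
def strictPassivitySet {n m : ℕ} (M : LTISystem n m) : Set ℝ :=
  {ξ : ℝ | (M.shift ξ).IsStrictlyPassive}

/-- `Ξ = sup {ξ | M_ξ is strictly passive}`. -/
noncomputable def Xi {n m : ℕ} (M : LTISystem n m) : ℝ :=
  sSup M.strictPassivitySet

/-- The upper bound for `Ξ` coming from stability of `A + (ξ/2) I` and from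
`Dᴴ + D - ξ I > 0`, namely `min (2 min_j (-Re λ_j(A))) (λ_min (Dᴴ + D))`. -/
noncomputable def XiUp {n m : ℕ} (M : LTISystem n m) : ℝ :=
  min (2 * sInf ((fun z : ℂ => -z.re) '' spectrum ℂ M.A)) (lambdaMin (M.Dᴴ + M.D))

/-- `γ(ξ, ω) = λ_min Φ_ξ(i ω)` for real `ω`. -/
noncomputable def gamma {n m : ℕ} (M : LTISystem n m) (ξ ω : ℝ) : ℝ :=
  lambdaMin ((M.shift ξ).Phi (Complex.I * (ω : ℂ)))

/-- `γ(ξ, ∞) = λ_min Φ_ξ(∞)`, the smallest eigenvalue of `Dᴴ + D - ξ I`. -/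
noncomputable def gammaInf {n m : ℕ} (M : LTISystem n m) (ξ : ℝ) : ℝ :=
  lambdaMin (M.shift ξ).PhiInf

/-- The natural domain of `γ`: the pairs `(ξ, ω)` such that `i ω` is not an eigenvalue of
`A + (ξ/2) I`, that is, such that the inverse in `Φ_ξ(i ω)` exists. -/
def gammaDomain {n m : ℕ} (M : LTISystem n m) : Set (ℝ × ℝ) :=
  {p : ℝ × ℝ | Complex.I * (p.2 : ℂ) ∉ spectrum ℂ (M.shift p.1).A}

end LTISystem

/-! The shift in `A` only moves the point of evaluation and the shift in `D` only subtracts a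
multiple of the identity, so `γ(ξ, ω)` is the smallest eigenvalue of `Tᴴ + T` at `i ω - ξ / 2`,
minus `ξ` (`gamma_eq`). Strict passivity thus bounds `Tᴴ + T` below on the line `Re s = -ξ / 2`, to
the right of the spectrum. Such a bound propagates to the right by Phragmén–Lindelöf
(`le_hermMin_transfer_of_boundary`), so the strictly passive shifts form a down-set; even
nonnegativity at a stable `η` gives strict passivity at every `ξ < η`. The set is also open:
compactness handles bounded `ω`, and `T → D` handles the rest. Hence `Ξ` itself is not strictly
passive, and as a limit of passive shifts from the left it must have a zero of `γ`. Beyond `Ξ`,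
nonnegativity of `γ` would make shifts larger than `Ξ` strictly passive. -/

/-! ### Variational characterization of the smallest eigenvalue -/

section SmallestEigenvalue

variable {m : ℕ}

/-- The Euclidean unit sphere of `ℂᵐ`. -/
def unitVectors (m : ℕ) : Set (Fin m → ℂ) := {x | ∑ i, ‖x i‖ ^ 2 = 1}

/-- The real part of the quadratic form `xᴴ H x`. -/
def reQuadForm (H : Matrix (Fin m) (Fin m) ℂ) (x : Fin m → ℂ) : ℝ := (star x ⬝ᵥ H *ᵥ x).re

lemma star_dotProduct_self_eq (x : Fin m → ℂ) :
    star x ⬝ᵥ x = ((∑ i, ‖x i‖ ^ 2 : ℝ) : ℂ) := by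
  simp [dotProduct, Complex.conj_mul']

lemma ne_zero_of_mem_unitVectors {x : Fin m → ℂ} (hx : x ∈ unitVectors m) : x ≠ 0 := by
  rintro rfl
  simp [unitVectors] at hx

lemma isCompact_unitVectors (m : ℕ) : IsCompact (unitVectors m) := by
  refine Metric.isCompact_of_isClosed_isBounded
    (isClosed_eq (by fun_prop) continuous_const) ?_
  refine (Metric.isBounded_closedBall (x := (0 : Fin m → ℂ)) (r := 1)).subset fun x hx => ?_
  rw [mem_closedBall_zero_iff, pi_norm_le_iff_of_nonneg zero_le_one]
  intro i
  have h := Finset.single_le_sum (f := fun i => ‖x i‖ ^ 2) (fun j _ => sq_nonneg _)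
    (Finset.mem_univ i)
  rw [show ∑ i, ‖x i‖ ^ 2 = 1 from hx] at h
  exact (sq_le_one_iff₀ (norm_nonneg _)).1 h

lemma continuous_reQuadForm :
    Continuous fun p : Matrix (Fin m) (Fin m) ℂ × (Fin m → ℂ) => reQuadForm p.1 p.2 := by
  unfold reQuadForm
  fun_prop

lemma reQuadForm_sub_smul_one (H : Matrix (Fin m) (Fin m) ℂ) (c : ℝ) {x : Fin m → ℂ}
    (hx : x ∈ unitVectors m) :
    reQuadForm (H - (c : ℂ) • 1) x = reQuadForm H x - c := by
  have h : ∑ i, ‖x i‖ ^ 2 = 1 := hx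
  simp [reQuadForm, Matrix.sub_mulVec, Matrix.smul_mulVec, star_dotProduct_self_eq, h]

lemma reQuadForm_conjTranspose (T : Matrix (Fin m) (Fin m) ℂ) (x : Fin m → ℂ) :
    reQuadForm Tᴴ x = reQuadForm T x := by
  have h : star x ⬝ᵥ Tᴴ *ᵥ x = star (star x ⬝ᵥ T *ᵥ x) := by
    rw [Matrix.star_dotProduct, Matrix.star_mulVec, Matrix.conjTranspose_conjTranspose,
      ← Matrix.dotProduct_mulVec]
  simp [reQuadForm, h]

lemma reQuadForm_conjTranspose_add_self (T : Matrix (Fin m) (Fin m) ℂ) (x : Fin m → ℂ) :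
    reQuadForm (Tᴴ + T) x = 2 * reQuadForm T x := by
  have h : reQuadForm (Tᴴ + T) x = reQuadForm Tᴴ x + reQuadForm T x := by
    simp [reQuadForm, Matrix.add_mulVec]
  rw [h, reQuadForm_conjTranspose, two_mul]

lemma lambdaMin_le_reQuadForm {H : Matrix (Fin m) (Fin m) ℂ} (hH : H.IsHermitian)
    {x : Fin m → ℂ} (hx : x ∈ unitVectors m) : lambdaMin H ≤ reQuadForm H x := by
  have hherm : (H - (lambdaMin H : ℂ) • (1 : Matrix (Fin m) (Fin m) ℂ)).IsHermitian := by
    refine hH.sub ?_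
    simp [Matrix.IsHermitian, Matrix.conjTranspose_smul]
  have hpos : (H - (lambdaMin H : ℂ) • (1 : Matrix (Fin m) (Fin m) ℂ)).PosSemidef := by
    rw [hherm.posSemidef_iff_eigenvalues_nonneg]
    intro i
    have heq : (lambdaMin H : ℂ) • (1 : Matrix (Fin m) (Fin m) ℂ)
        = algebraMap ℝ _ (lambdaMin H) := by
      rw [Algebra.algebraMap_eq_smul_one]
      simp
    have hmem : hherm.eigenvalues i ∈ spectrum ℝ (H - algebraMap ℝ _ (lambdaMin H)) :=
      heq ▸ hherm.eigenvalues_mem_spectrum_real i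
    rw [← spectrum.sub_singleton_eq] at hmem
    obtain ⟨a, ha, b, rfl, hab⟩ := hmem
    exact (sub_nonneg.2 (csInf_le Matrix.finite_real_spectrum.bddBelow ha)).trans_eq hab
  have h := (Matrix.posSemidef_iff_dotProduct_mulVec.1 hpos).2 x
  have h' : 0 ≤ reQuadForm (H - (lambdaMin H : ℂ) • 1) x := (Complex.le_def.1 h).1
  rw [reQuadForm_sub_smul_one H _ hx] at h'
  linarith

/-- A unit eigenvector attains the minimum. Positivity of `m` keeps the spectrum nonempty, so that
`sInf` is not a default value. -/
lemma exists_reQuadForm_eq_lambdaMin (hm : 0 < m) {H : Matrix (Fin m) (Fin m) ℂ}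
    (hH : H.IsHermitian) : ∃ x ∈ unitVectors m, reQuadForm H x = lambdaMin H := by
  have hne : (spectrum ℝ H).Nonempty := ⟨_, hH.eigenvalues_mem_spectrum_real ⟨0, hm⟩⟩
  have hmem : lambdaMin H ∈ spectrum ℝ H := hne.csInf_mem Matrix.finite_real_spectrum
  rw [hH.spectrum_real_eq_range_eigenvalues] at hmem
  obtain ⟨i, hi⟩ := hmem
  have hnorm := hH.eigenvectorBasis.orthonormal.1 i
  have hunit : (hH.eigenvectorBasis i).ofLp ∈ unitVectors m := by
    have h := EuclideanSpace.norm_sq_eq (hH.eigenvectorBasis i)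
    rw [hnorm] at h
    simpa [unitVectors] using h.symm
  refine ⟨_, hunit, ?_⟩
  have h1 : ∑ j, ‖(hH.eigenvectorBasis i).ofLp j‖ ^ 2 = 1 := hunit
  rw [reQuadForm, hH.mulVec_eigenvectorBasis, dotProduct_smul, star_dotProduct_self_eq, h1, hi]
  simp

lemma lambdaMin_eq_sInf_reQuadForm (hm : 0 < m) {H : Matrix (Fin m) (Fin m) ℂ}
    (hH : H.IsHermitian) : lambdaMin H = sInf (reQuadForm H '' unitVectors m) := by
  obtain ⟨x, hx, hxe⟩ := exists_reQuadForm_eq_lambdaMin hm hH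
  have hleast : IsLeast (reQuadForm H '' unitVectors m) (lambdaMin H) := by
    refine ⟨⟨x, hx, hxe⟩, ?_⟩
    rintro _ ⟨y, hy, rfl⟩
    exact lambdaMin_le_reQuadForm hH hy
  exact hleast.csInf_eq.symm

lemma le_lambdaMin_iff (hm : 0 < m) {H : Matrix (Fin m) (Fin m) ℂ} (hH : H.IsHermitian)
    {c : ℝ} : c ≤ lambdaMin H ↔ ∀ x ∈ unitVectors m, c ≤ reQuadForm H x := by
  refine ⟨fun h x hx => h.trans (lambdaMin_le_reQuadForm hH hx), fun h => ?_⟩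
  obtain ⟨x, hx, hxe⟩ := exists_reQuadForm_eq_lambdaMin hm hH
  exact hxe ▸ h x hx

lemma lambdaMin_sub_smul_one (hm : 0 < m) {H : Matrix (Fin m) (Fin m) ℂ} (hH : H.IsHermitian)
    (c : ℝ) : lambdaMin (H - (c : ℂ) • 1) = lambdaMin H - c := by
  have hherm : (H - (c : ℂ) • (1 : Matrix (Fin m) (Fin m) ℂ)).IsHermitian := by
    refine hH.sub ?_
    simp [Matrix.IsHermitian, Matrix.conjTranspose_smul]
  refine eq_of_forall_le_iff fun d => ?_
  rw [le_lambdaMin_iff hm hherm, le_sub_iff_add_le, le_lambdaMin_iff hm hH]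
  refine forall₂_congr fun x hx => ?_
  rw [reQuadForm_sub_smul_one H c hx, le_sub_iff_add_le]

lemma posDef_iff_lambdaMin_pos (hm : 0 < m) {H : Matrix (Fin m) (Fin m) ℂ}
    (hH : H.IsHermitian) : H.PosDef ↔ 0 < lambdaMin H := by
  constructor
  · intro h
    obtain ⟨x, hx, hxe⟩ := exists_reQuadForm_eq_lambdaMin hm hH
    rw [← hxe]
    exact h.re_dotProduct_pos (ne_zero_of_mem_unitVectors hx)
  · intro h
    rw [hH.posDef_iff_eigenvalues_pos]
    exact fun i => h.trans_le (csInf_le Matrix.finite_real_spectrum.bddBelow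
      (hH.eigenvalues_mem_spectrum_real i))

/-- The smallest eigenvalue of the Hermitian matrix `Tᴴ + T`. -/
noncomputable def hermMin (T : Matrix (Fin m) (Fin m) ℂ) : ℝ := lambdaMin (Tᴴ + T)

lemma isHermitian_conjTranspose_add_self (T : Matrix (Fin m) (Fin m) ℂ) :
    (Tᴴ + T).IsHermitian := by
  simp [Matrix.IsHermitian, Matrix.conjTranspose_add, add_comm]

/-- The infimum of a jointly continuous function over a fixed compact set, here the unit sphere,
depends continuously on the parameter. -/
lemma continuous_hermMin (hm : 0 < m) :
    Continuous (hermMin : Matrix (Fin m) (Fin m) ℂ → ℝ) := by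
  have h : (hermMin : Matrix (Fin m) (Fin m) ℂ → ℝ)
      = fun T => sInf (reQuadForm (Tᴴ + T) '' unitVectors m) :=
    funext fun T => lambdaMin_eq_sInf_reQuadForm hm (isHermitian_conjTranspose_add_self T)
  rw [h]
  refine (isCompact_unitVectors m).continuous_sInf (f := fun T => reQuadForm (Tᴴ + T)) ?_
  exact continuous_reQuadForm.comp
    (((continuous_fst.matrix_conjTranspose).add continuous_fst).prodMk continuous_snd)

lemma le_hermMin_iff (hm : 0 < m) {T : Matrix (Fin m) (Fin m) ℂ} {c : ℝ} :
    c ≤ hermMin T ↔ ∀ x ∈ unitVectors m, c ≤ 2 * reQuadForm T x := by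
  rw [hermMin, le_lambdaMin_iff hm (isHermitian_conjTranspose_add_self T)]
  simp only [reQuadForm_conjTranspose_add_self]

end SmallestEigenvalue
open Filter Topology
namespace LTISystem

variable {n m : ℕ} (M : LTISystem n m)

/-! ### Regularity of the transfer function and its limit at infinity -/

section Transfer

-- Resolvent calculus needs a Banach algebra norm; this one induces the entrywise topology.
attribute [local instance] Matrix.linftyOpNormedRing Matrix.linftyOpNormedAlgebra

lemma transfer_eq_resolvent (s : ℂ) : M.transfer s = M.C * resolvent M.A s * M.B + M.D := by
  rw [transfer, Matrix.nonsing_inv_eq_ringInverse, resolvent, Algebra.algebraMap_eq_smul_one]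

lemma continuousAt_transfer {s : ℂ} (hs : s ∉ spectrum ℂ M.A) : ContinuousAt M.transfer s := by
  have h : ContinuousAt (resolvent M.A) s :=
    (spectrum.hasDerivAt_resolvent_const_left (not_not.1 hs)).continuousAt
  have h' : Continuous fun R : Matrix (Fin n) (Fin n) ℂ => M.C * R * M.B + M.D := by fun_prop
  have := h'.continuousAt.comp h
  exact this.congr (.of_forall fun z => (M.transfer_eq_resolvent z).symm)

lemma tendsto_transfer_cobounded : Tendsto M.transfer (Bornology.cobounded ℂ) (𝓝 M.D) := by
  have h : Tendsto (resolvent M.A) (Bornology.cobounded ℂ) (𝓝 0) :=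
    spectrum.resolvent_tendsto_cobounded M.A
  have h' : Continuous fun R : Matrix (Fin n) (Fin n) ℂ => M.C * R * M.B + M.D := by fun_prop
  have := (h'.tendsto 0).comp h
  simp only [Matrix.mul_zero, Matrix.zero_mul, zero_add] at this
  exact this.congr fun z => (M.transfer_eq_resolvent z).symm

lemma differentiableAt_quadForm_transfer (x : Fin m → ℂ) {s : ℂ} (hs : s ∉ spectrum ℂ M.A) :
    DifferentiableAt ℂ (fun z => star x ⬝ᵥ M.transfer z *ᵥ x) s := by
  have h : DifferentiableAt ℂ (resolvent M.A) s :=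
    (spectrum.hasDerivAt_resolvent_const_left (not_not.1 hs)).differentiableAt
  let Λ : Matrix (Fin n) (Fin n) ℂ →ₗ[ℂ] ℂ :=
    { toFun := fun R => star x ⬝ᵥ (M.C * R * M.B) *ᵥ x
      map_add' := fun R S => by
        simp [Matrix.mul_add, Matrix.add_mul, Matrix.add_mulVec, dotProduct_add]
      map_smul' := fun c R => by
        simp [Matrix.smul_mulVec, dotProduct_smul] }
  have hΛ : DifferentiableAt ℂ (fun z => Λ.toContinuousLinearMap (resolvent M.A z)) s :=
    Λ.toContinuousLinearMap.differentiableAt.comp s h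
  refine (hΛ.add_const (star x ⬝ᵥ M.D *ᵥ x)).congr_of_eventuallyEq (.of_forall fun z => ?_)
  simp [Λ, transfer_eq_resolvent, Matrix.add_mulVec, dotProduct_add]

lemma eventually_notMem_spectrum_cobounded :
    ∀ᶠ s in Bornology.cobounded ℂ, s ∉ spectrum ℂ M.A :=
  (Matrix.finite_spectrum M.A).isBounded

end Transfer

/-- Maximum principle: a lower bound for `Tᴴ + T` on the boundary of a half plane free of
eigenvalues of `A` propagates to the half plane. -/
lemma le_hermMin_transfer_of_boundary (hm : 0 < m) {a c : ℝ}
    (hspec : ∀ z ∈ spectrum ℂ M.A, z.re < a)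
    (hbd : ∀ ω : ℝ, c ≤ hermMin (M.transfer (a + ω * Complex.I))) {s : ℂ} (hs : a ≤ s.re) :
    c ≤ hermMin (M.transfer s) := by
  rw [le_hermMin_iff hm]
  intro x hx
  have hnot : ∀ z : ℂ, 0 ≤ z.re → a + z ∉ spectrum ℂ M.A := fun z hz h => by
    have := hspec _ h
    simp at this
    linarith
  set q : ℂ → ℂ := fun z => star x ⬝ᵥ M.transfer (a + z) *ᵥ x with hq
  have hqdiff : ∀ z : ℂ, 0 ≤ z.re → DifferentiableAt ℂ q z := fun z hz =>
    (M.differentiableAt_quadForm_transfer x (hnot z hz)).comp z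
      ((differentiableAt_const _).add differentiableAt_id)
  have hqlim : Tendsto q (Bornology.cobounded ℂ) (𝓝 (star x ⬝ᵥ M.D *ᵥ x)) := by
    have h1 : Tendsto (fun z : ℂ => (a : ℂ) + z) (Bornology.cobounded ℂ)
        (Bornology.cobounded ℂ) := tendsto_const_add_cobounded _
    have h2 : Continuous fun T : Matrix (Fin m) (Fin m) ℂ => star x ⬝ᵥ T *ᵥ x := by fun_prop
    exact (h2.tendsto M.D).comp (M.tendsto_transfer_cobounded.comp h1)
  -- The modulus of `exp (-q)` is `exp (-Re q)`, which turns a lower bound on `Re q` into an upper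
  -- bound on a modulus. The constant is `c / 2` because `Tᴴ + T` has quadratic form `2 Re q`.
  have hflim : Tendsto (fun z => Complex.exp (-q z)) (Bornology.cobounded ℂ)
      (𝓝 (Complex.exp (-(star x ⬝ᵥ M.D *ᵥ x)))) :=
    (Complex.continuous_exp.tendsto _).comp hqlim.neg
  have key : ‖Complex.exp (-q (s - a))‖ ≤ Real.exp (-(c / 2)) := by
    refine PhragmenLindelof.right_half_plane_of_bounded_on_real
      (f := fun z => Complex.exp (-q z)) ?_ ⟨1, one_lt_two, 0, ?_⟩ ?_ ?_ (by simpa using hs)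
    · refine DifferentiableOn.diffContOnCl fun z hz => ?_
      rw [Complex.closure_setOfPred_lt_re] at hz
      exact (hqdiff z hz).neg.cexp.differentiableWithinAt
    -- The limit at infinity makes the function bounded there, so growth order `1` with coefficient
    -- `0` suffices.
    · simp only [zero_mul, Real.exp_zero]
      exact (hflim.isBigO_one ℝ).mono inf_le_left
    · have hre : Tendsto (fun x : ℝ => (x : ℂ)) atTop (Bornology.cobounded ℂ) := by
        rw [← tendsto_norm_atTop_iff_cobounded]
        simpa using tendsto_abs_atTop_atTop
      exact (hflim.comp hre).norm.isBoundedUnder_le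
    · intro ω
      rw [Complex.norm_exp, Real.exp_le_exp, Complex.neg_re, neg_le_neg_iff]
      have := (le_hermMin_iff hm).1 (hbd ω) x hx
      change c / 2 ≤ reQuadForm (M.transfer (a + ω * Complex.I)) x
      linarith
  rw [Complex.norm_exp, Real.exp_le_exp, Complex.neg_re, neg_le_neg_iff] at key
  have hkey : c / 2 ≤ reQuadForm (M.transfer (a + (s - a))) x := key
  rw [add_sub_cancel] at hkey
  linarith

/-! ### The shift as a translation of the evaluation line -/

/-- The point `i ω - ξ / 2` at which `γ(ξ, ω)` evaluates the transfer function. -/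
noncomputable def linePoint (ξ ω : ℝ) : ℂ := ((-(ξ / 2) : ℝ) : ℂ) + ω * Complex.I

lemma continuous_linePoint : Continuous fun p : ℝ × ℝ => linePoint p.1 p.2 := by
  unfold linePoint
  fun_prop

@[simp] lemma linePoint_re (ξ ω : ℝ) : (linePoint ξ ω).re = -(ξ / 2) := by simp [linePoint]

@[simp] lemma linePoint_im (ξ ω : ℝ) : (linePoint ξ ω).im = ω := by simp [linePoint]

lemma mem_spectrum_shift_iff (ξ : ℝ) (z : ℂ) :
    z ∈ spectrum ℂ (M.shift ξ).A ↔ z - (ξ : ℂ) / 2 ∈ spectrum ℂ M.A := by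
  have h := spectrum.add_mem_add_iff (R := ℂ) (a := M.A) (r := z - (ξ : ℂ) / 2)
    (s := (ξ : ℂ) / 2)
  rw [sub_add_cancel, Algebra.algebraMap_eq_smul_one, add_comm] at h
  exact h

lemma mem_gammaDomain_iff (ξ ω : ℝ) :
    (ξ, ω) ∈ M.gammaDomain ↔ linePoint ξ ω ∉ spectrum ℂ M.A := by
  have h : Complex.I * (ω : ℂ) - (ξ : ℂ) / 2 = linePoint ξ ω := by
    simp [linePoint]
    ring
  rw [← h, ← mem_spectrum_shift_iff]
  rfl

lemma isStable_shift_iff (ξ : ℝ) :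
    (M.shift ξ).IsStable ↔ ∀ z ∈ spectrum ℂ M.A, z.re < -(ξ / 2) := by
  constructor
  · intro h z hz
    have := h (z + (ξ : ℂ) / 2) ((M.mem_spectrum_shift_iff ξ _).2 (by simpa using hz))
    simp at this
    linarith
  · intro h z hz
    have := h _ ((M.mem_spectrum_shift_iff ξ _).1 hz)
    simp at this
    linarith

lemma transfer_shift (ξ ω : ℝ) :
    (M.shift ξ).transfer (Complex.I * ω) = M.transfer (linePoint ξ ω) - ((ξ : ℂ) / 2) • 1 := by
  have h : (Complex.I * (ω : ℂ)) • (1 : Matrix (Fin n) (Fin n) ℂ)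
      - (M.A + ((ξ : ℂ) / 2) • (1 : Matrix (Fin n) (Fin n) ℂ)) = linePoint ξ ω • 1 - M.A := by
    rw [add_comm, ← sub_sub, ← sub_smul]
    congr 2
    simp [linePoint]
    ring
  simp only [transfer, shift]
  rw [h, add_sub_assoc]

lemma conjTranspose_add_self_sub (T : Matrix (Fin m) (Fin m) ℂ) (ξ : ℝ) :
    (T - ((ξ : ℂ) / 2) • 1)ᴴ + (T - ((ξ : ℂ) / 2) • 1) = Tᴴ + T - (ξ : ℂ) • 1 := by
  have h : star ((ξ : ℂ) / 2) = (ξ : ℂ) / 2 := by simp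
  have h2 : (ξ : ℂ) • (1 : Matrix (Fin m) (Fin m) ℂ)
      = ((ξ : ℂ) / 2) • 1 + ((ξ : ℂ) / 2) • 1 := by
    rw [← add_smul, add_halves]
  rw [Matrix.conjTranspose_sub, Matrix.conjTranspose_smul, Matrix.conjTranspose_one, h, h2]
  abel

lemma phi_shift (ξ ω : ℝ) :
    (M.shift ξ).Phi (Complex.I * ω)
      = (M.transfer (linePoint ξ ω))ᴴ + M.transfer (linePoint ξ ω) - (ξ : ℂ) • 1 := by
  have h : -(starRingEnd ℂ (Complex.I * ω)) = Complex.I * ω := by simp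
  rw [Phi, h, transfer_shift, conjTranspose_add_self_sub]

lemma phiInf_shift (ξ : ℝ) : (M.shift ξ).PhiInf = M.Dᴴ + M.D - (ξ : ℂ) • 1 :=
  conjTranspose_add_self_sub M.D ξ

lemma gamma_eq (hm : 0 < m) (ξ ω : ℝ) :
    M.gamma ξ ω = hermMin (M.transfer (linePoint ξ ω)) - ξ := by
  rw [gamma, phi_shift, lambdaMin_sub_smul_one hm (isHermitian_conjTranspose_add_self _)]
  rfl

lemma gammaInf_eq (hm : 0 < m) (ξ : ℝ) : M.gammaInf ξ = hermMin M.D - ξ := by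
  rw [gammaInf, phiInf_shift, lambdaMin_sub_smul_one hm (isHermitian_conjTranspose_add_self _)]
  rfl

lemma mem_strictPassivitySet_iff (hm : 0 < m) (ξ : ℝ) :
    ξ ∈ M.strictPassivitySet ↔ (∀ z ∈ spectrum ℂ M.A, z.re < -(ξ / 2)) ∧
      (∀ ω : ℝ, 0 < M.gamma ξ ω) ∧ 0 < M.gammaInf ξ := by
  have h1 : ∀ ω : ℝ, ((M.shift ξ).Phi (Complex.I * ω)).PosDef ↔ 0 < M.gamma ξ ω := fun ω => by
    refine posDef_iff_lambdaMin_pos hm ?_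
    rw [phi_shift, ← conjTranspose_add_self_sub]
    exact isHermitian_conjTranspose_add_self _
  have h2 : (M.shift ξ).PhiInf.PosDef ↔ 0 < M.gammaInf ξ :=
    posDef_iff_lambdaMin_pos hm (isHermitian_conjTranspose_add_self _)
  rw [← isStable_shift_iff, ← h2]
  simp only [← h1]
  rfl

lemma continuousAt_gamma (hm : 0 < m) {p : ℝ × ℝ} (hp : p ∈ M.gammaDomain) :
    ContinuousAt (fun p : ℝ × ℝ => M.gamma p.1 p.2) p := by
  simp only [M.gamma_eq hm]
  have h : ContinuousAt (fun p : ℝ × ℝ => M.transfer (linePoint p.1 p.2)) p :=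
    ContinuousAt.comp (f := fun p : ℝ × ℝ => linePoint p.1 p.2)
      (M.continuousAt_transfer ((M.mem_gammaDomain_iff _ _).1 hp))
      continuous_linePoint.continuousAt
  exact ((continuous_hermMin hm).continuousAt.comp h).sub continuousAt_fst

/-! ### Structure of the set of strictly passive shifts -/

lemma exists_radius_hermMin_transfer (hm : 0 < m) {c : ℝ} (hc : c < hermMin M.D) :
    ∃ R : ℝ, ∀ s : ℂ, R < ‖s‖ → s ∉ spectrum ℂ M.A ∧ c < hermMin (M.transfer s) := by
  have h := ((continuous_hermMin hm).tendsto M.D).comp M.tendsto_transfer_cobounded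
  have h' := M.eventually_notMem_spectrum_cobounded.and (h.eventually_const_lt hc)
  rw [← comap_norm_atTop, eventually_comap] at h'
  obtain ⟨R, hR⟩ := eventually_atTop.1 h'
  exact ⟨R, fun s hs => hR _ hs.le s rfl⟩

/-- Strict passivity at all smaller shifts follows from stability and passivity at one shift. -/
lemma mem_strictPassivitySet_of_lt (hm : 0 < m) {ξ η : ℝ} (hlt : ξ < η)
    (hspec : ∀ z ∈ spectrum ℂ M.A, z.re < -(η / 2)) (hγ : ∀ ω : ℝ, 0 ≤ M.gamma η ω)
    (hinf : 0 ≤ M.gammaInf η) : ξ ∈ M.strictPassivitySet := by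
  rw [mem_strictPassivitySet_iff M hm]
  refine ⟨fun z hz => (hspec z hz).trans (by linarith), fun ω => ?_, ?_⟩
  -- Nonnegativity of `γ(η, ·)` is the bound `η` on `Re s = -η / 2`; carried right to `Re s = -ξ /
  -- 2`, it gives `γ(ξ, ω) ≥ η - ξ > 0`.
  · have h := M.le_hermMin_transfer_of_boundary hm hspec (c := η) (fun ω => ?_)
      (s := linePoint ξ ω) (by simp; linarith)
    · rw [gamma_eq M hm]
      linarith
    · have := hγ ω
      rw [gamma_eq M hm] at this
      exact sub_nonneg.1 this
  · rw [gammaInf_eq M hm] at *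
    linarith

lemma mem_strictPassivitySet_of_lt_mem (hm : 0 < m) {ξ η : ℝ} (hlt : ξ < η)
    (hη : η ∈ M.strictPassivitySet) : ξ ∈ M.strictPassivitySet := by
  rw [mem_strictPassivitySet_iff M hm] at hη
  exact M.mem_strictPassivitySet_of_lt hm hlt hη.1 (fun ω => (hη.2.1 ω).le) hη.2.2.le

lemma bddAbove_strictPassivitySet (hn : 0 < n) : BddAbove M.strictPassivitySet := by
  have : Nonempty (Fin n) := ⟨⟨0, hn⟩⟩
  obtain ⟨z, hz⟩ := spectrum.nonempty_of_isAlgClosed_of_finiteDimensional ℂ M.A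
  refine ⟨-2 * z.re, fun ξ hξ => ?_⟩
  have := (M.isStable_shift_iff ξ).1 hξ.1 z hz
  linarith

lemma strictPassivitySet_nonempty (hm : 0 < m) : M.strictPassivitySet.Nonempty := by
  obtain ⟨R, hR⟩ := M.exists_radius_hermMin_transfer hm (sub_one_lt (hermMin M.D))
  obtain ⟨K, hK⟩ := ((Matrix.finite_spectrum M.A).image Complex.re).bddAbove
  -- The shift `-2 * a` evaluates on `Re s = a`: this lies right of the spectrum (`K`) and where `T`
  -- is near `D` (`R`), and the third bound makes `-2 * a` smaller than `hermMin M.D - 1`.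
  obtain ⟨a, ha⟩ := exists_gt (max (max R K) (-(hermMin M.D - 1) / 2))
  rw [max_lt_iff, max_lt_iff] at ha
  refine ⟨-2 * a, (M.mem_strictPassivitySet_iff hm _).2 ⟨fun z hz => ?_, fun ω => ?_, ?_⟩⟩
  · have := hK ⟨z, hz, rfl⟩
    linarith [ha.1.2]
  · have hre : (linePoint (-2 * a) ω).re = a := by
      rw [linePoint_re]
      ring
    have h := (hR (linePoint (-2 * a) ω)
      (ha.1.1.trans_le (hre.symm.trans_le (Complex.re_le_norm _)))).2
    rw [gamma_eq M hm]
    linarith [ha.2]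
  · rw [gammaInf_eq M hm]
    linarith [ha.2]

lemma isLUB_Xi (hn : 0 < n) (hm : 0 < m) : IsLUB M.strictPassivitySet M.Xi :=
  isLUB_csSup (M.strictPassivitySet_nonempty hm) (M.bddAbove_strictPassivitySet hn)

lemma mem_strictPassivitySet_of_lt_Xi (hn : 0 < n) (hm : 0 < m) {ξ : ℝ} (hξ : ξ < M.Xi) :
    ξ ∈ M.strictPassivitySet := by
  obtain ⟨η, hη, hlt⟩ := (lt_isLUB_iff (M.isLUB_Xi hn hm)).1 hξ
  exact M.mem_strictPassivitySet_of_lt_mem hm hlt hη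

lemma mem_gammaDomain_of_spectrum_re_lt {ξ : ℝ} (h : ∀ z ∈ spectrum ℂ M.A, z.re < -(ξ / 2))
    (ω : ℝ) : (ξ, ω) ∈ M.gammaDomain :=
  (M.mem_gammaDomain_iff ξ ω).2 fun hmem => by simpa using h _ hmem

/-- An eigenvalue `z` with equality would lie on the evaluation line at `ω = Im z`, where `γ` is
undefined. -/
lemma spectrum_re_lt_of_le {ξ : ℝ} (hle : ∀ z ∈ spectrum ℂ M.A, z.re ≤ -(ξ / 2))
    (hdom : ∀ ω : ℝ, (ξ, ω) ∈ M.gammaDomain) : ∀ z ∈ spectrum ℂ M.A, z.re < -(ξ / 2) := by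
  intro z hz
  refine (hle z hz).lt_of_ne fun heq => (M.mem_gammaDomain_iff ξ z.im).1 (hdom z.im) ?_
  rwa [show linePoint ξ z.im = z from Complex.ext (by simp [heq]) (by simp)]

/-- Strict passivity is an open condition on the shift. -/
lemma eventually_mem_strictPassivitySet (hm : 0 < m) {ξ₀ : ℝ} (h : ξ₀ ∈ M.strictPassivitySet) :
    ∀ᶠ ξ in 𝓝 ξ₀, ξ ∈ M.strictPassivitySet := by
  rw [mem_strictPassivitySet_iff M hm] at h
  obtain ⟨hspec, hγ, hinf⟩ := h
  have hD : ξ₀ < hermMin M.D := by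
    rw [gammaInf_eq M hm] at hinf
    linarith
  -- The gap between `ξ₀` and `c` gives one radius `R` that works for all `ξ < c` when `|ω| > R`;
  -- only a compact range of `ω` remains.
  obtain ⟨c, hc₀, hcD⟩ := exists_between hD
  obtain ⟨R, hR⟩ := M.exists_radius_hermMin_transfer hm hcD
  have hspec' : ∀ᶠ ξ in 𝓝 ξ₀, ∀ z ∈ spectrum ℂ M.A, z.re < -(ξ / 2) := by
    rw [(Matrix.finite_spectrum M.A).eventually_all]
    intro z hz
    have hcont : Continuous fun ξ : ℝ => -(ξ / 2) := by fun_prop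
    exact hcont.continuousAt.eventually_const_lt (hspec z hz)
  have hcompact : ∀ᶠ ξ in 𝓝 ξ₀, ∀ ω ∈ Set.Icc (-R) R, 0 < M.gamma ξ ω := by
    refine isCompact_Icc.eventually_forall_of_forall_eventually fun ω _ => ?_
    exact (M.continuousAt_gamma hm
      (M.mem_gammaDomain_of_spectrum_re_lt hspec ω)).eventually_const_lt (hγ ω)
  filter_upwards [hspec', hcompact, eventually_lt_nhds hc₀] with ξ h1 h2 h3
  refine (M.mem_strictPassivitySet_iff hm ξ).2 ⟨h1, fun ω => ?_, ?_⟩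
  · by_cases hω : ω ∈ Set.Icc (-R) R
    · exact h2 ω hω
    · have habs : R < |ω| := by
        by_contra! hle
        exact hω (abs_le.1 hle)
      have := (hR (linePoint ξ ω) (habs.trans_le
        (by simpa using Complex.abs_im_le_norm (linePoint ξ ω)))).2
      rw [gamma_eq M hm]
      linarith
  · rw [gammaInf_eq M hm]
    linarith

/-! ### Behaviour at and beyond the critical shift -/

lemma Xi_notMem_strictPassivitySet (hn : 0 < n) (hm : 0 < m) :
    M.Xi ∉ M.strictPassivitySet := by
  intro h
  obtain ⟨ξ, hξ, hmem⟩ :=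
    ((eventually_nhdsWithin_of_forall (s := Set.Ioi M.Xi) fun _ h => h).and
      (nhdsWithin_le_nhds (M.eventually_mem_strictPassivitySet hm h))).exists
  exact absurd ((M.isLUB_Xi hn hm).1 hmem) (not_le.2 hξ)

/-- Letting `ξ` increase to `Ξ` turns strict inequalities into weak ones. Without a zero, and with
no eigenvalue on the line, all are strict again, which would make `Ξ` strictly passive. -/
lemma exists_gamma_Xi_eq_zero (hn : 0 < n) (hm : 0 < m)
    (hdom : ∀ ω : ℝ, (M.Xi, ω) ∈ M.gammaDomain) :
    (∃ ω : ℝ, M.gamma M.Xi ω = 0) ∨ M.gammaInf M.Xi = 0 := by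
  by_contra! hne
  have hlt : ∀ ξ ∈ Set.Iio M.Xi, (∀ z ∈ spectrum ℂ M.A, z.re < -(ξ / 2)) ∧
      (∀ ω : ℝ, 0 < M.gamma ξ ω) ∧ 0 < M.gammaInf ξ := fun ξ hξ =>
    (M.mem_strictPassivitySet_iff hm ξ).1 (M.mem_strictPassivitySet_of_lt_Xi hn hm hξ)
  have hleft : ∀ {f : ℝ → ℝ}, ContinuousAt f M.Xi → (∀ ξ ∈ Set.Iio M.Xi, 0 < f ξ) →
      0 ≤ f M.Xi := fun {f} hf hpos =>
    ge_of_tendsto (hf.tendsto.mono_left (nhdsWithin_le_nhds (s := Set.Iio M.Xi)))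
      (eventually_nhdsWithin_of_forall fun ξ hξ => (hpos ξ hξ).le)
  refine M.Xi_notMem_strictPassivitySet hn hm ((M.mem_strictPassivitySet_iff hm _).2
    ⟨M.spectrum_re_lt_of_le (fun z hz => ?_) hdom, fun ω => ?_, ?_⟩)
  · have := hleft (f := fun ξ => -(ξ / 2) - z.re)
      (Continuous.continuousAt (by fun_prop)) fun ξ hξ => sub_pos.2 ((hlt ξ hξ).1 z hz)
    exact sub_nonneg.1 this
  · refine (hleft (f := fun ξ => M.gamma ξ ω) ?_ fun ξ hξ => (hlt ξ hξ).2.1 ω).lt_of_ne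
      (hne.1 ω).symm
    exact ContinuousAt.comp (f := fun ξ : ℝ => (ξ, ω)) (M.continuousAt_gamma hm (hdom ω))
      (by fun_prop)
  · refine (hleft (f := M.gammaInf) ?_ fun ξ hξ => (hlt ξ hξ).2.2).lt_of_ne hne.2.symm
    rw [show M.gammaInf = fun ξ => hermMin M.D - ξ from funext (M.gammaInf_eq hm)]
    fun_prop

lemma exists_Ioo_gamma_neg (hn : 0 < n) (hm : 0 < m) {ξ : ℝ} (hlt : M.Xi < ξ)
    (hle : ξ ≤ M.XiUp) (hdom : ∀ ω : ℝ, (ξ, ω) ∈ M.gammaDomain) :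
    ∃ a b : ℝ, a < b ∧ ∀ ω ∈ Set.Ioo a b, M.gamma ξ ω < 0 := by
  obtain ⟨hA, hD⟩ := le_min_iff.1 hle
  have hspec := M.spectrum_re_lt_of_le (fun z hz => by
    have := csInf_le ((Matrix.finite_spectrum M.A).image fun z : ℂ => -z.re).bddBelow
      (Set.mem_image_of_mem _ hz)
    linarith) hdom
  -- Otherwise every `η` between `Ξ` and `ξ` would be strictly passive; the `D` part of `XiUp`
  -- supplies the condition at `ω = ∞`.
  have hneg : ∃ ω : ℝ, M.gamma ξ ω < 0 := by
    by_contra! hnn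
    obtain ⟨η, hη, hηξ⟩ := exists_between hlt
    have hmem := M.mem_strictPassivitySet_of_lt hm hηξ hspec hnn
      (by rw [gammaInf_eq M hm]; exact sub_nonneg.2 hD)
    exact absurd ((M.isLUB_Xi hn hm).1 hmem) (not_le.2 hη)
  obtain ⟨ω, hω⟩ := hneg
  have hcont : ContinuousAt (fun ω => M.gamma ξ ω) ω :=
    ContinuousAt.comp (f := fun ω : ℝ => (ξ, ω)) (M.continuousAt_gamma hm (hdom ω))
      (by fun_prop)
  obtain ⟨a, b, hab, hsub⟩ := mem_nhds_iff_exists_Ioo_subset.1 (hcont.eventually_lt_const hω)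
  exact ⟨a, b, hab.1.trans hab.2, fun _ h => hsub h⟩

end LTISystem

theorem mainTheorem5 (n m : ℕ) (hn : 0 < n) (hm : 0 < m) (M : LTISystem n m)
    (hmin : M.IsMinimal) :
    IsLUB M.strictPassivitySet M.Xi ∧
    ContinuousOn (fun p : ℝ × ℝ => M.gamma p.1 p.2) M.gammaDomain ∧
    (∀ ξ : ℝ, 0 ≤ ξ → ξ < M.Xi →
      (∀ ω : ℝ, (ξ, ω) ∈ M.gammaDomain ∧ 0 < M.gamma ξ ω) ∧ 0 < M.gammaInf ξ) ∧
    ((∀ ω : ℝ, (M.Xi, ω) ∈ M.gammaDomain) →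
      (∃ ω : ℝ, M.gamma M.Xi ω = 0) ∨ M.gammaInf M.Xi = 0) ∧
    (∀ ξ : ℝ, M.Xi < ξ → ξ ≤ M.XiUp → (∀ ω : ℝ, (ξ, ω) ∈ M.gammaDomain) →
      ∃ a b : ℝ, a < b ∧ ∀ ω ∈ Set.Ioo a b, M.gamma ξ ω < 0) := by
  refine ⟨M.isLUB_Xi hn hm, fun p hp => (M.continuousAt_gamma hm hp).continuousWithinAt,
    fun ξ _ hξ => ?_, M.exists_gamma_Xi_eq_zero hn hm,
    fun ξ hlt hle hdom => M.exists_Ioo_gamma_neg hn hm hlt hle hdom⟩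
  have h := (M.mem_strictPassivitySet_iff hm ξ).1 (M.mem_strictPassivitySet_of_lt_Xi hn hm hξ)
  exact ⟨fun ω => ⟨M.mem_gammaDomain_of_spectrum_re_lt h.1 ω, h.2.1 ω⟩, h.2.2⟩
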